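/- Let $\mathbb S^2\subset\mathbb R^3$ be the unit sphere with surface (two-dimensional Hausdorff) measure $dp$, let $\mathrm{Sym}_0(3)$ be the set of traceless symmetric real $3\times3$ matrices with inner product $A\cdot B=\sum_{i,j}A_{ij}B_{ij}$, let $\mathcal Q$ be the set of $Q\in\mathrm{Sym}_0(3)$ all of whose eigenvalues are $>-\tfrac13$, and let $\mathcal P(\mathbb S^2)=\{f\in L^1(\mathbb S^2): f\ge 0\text{ a.e.},\ \int_{\mathbb S^2} f\,dp=1\}$. Fix $\eta\in\mathbb R$ and define $\mathcal F:\mathcal P(\mathbb S^2)\to\mathbb R\cup\{+\infty\}$ by $$\mathcal F(f)=\int_{\mathbb S^2} f(p)\ln f(p)-f(p)\ln\Big(\int_{\mathbb S^2}\big((p\cdot q)^2-\tfrac13\big)f(q)\,dq-\eta\Big)\,dp,$$ where $-\ln$ is extended by $+\infty$ to non-positive arguments and $0\cdot(+\infty)=0$. For $Q\in\mathcal Q$ let $$J(Q)=\inf\Big\{\mathcal F(f): f\in\mathcal P(\mathbb S^2),\ \int_{\mathbb S^2}\big(p\otimes p-\tfrac13I\big)f(p)\,dp=Q\Big\},\qquad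 \mathrm{dom}(J)=\{Q\in\mathcal Q: J(Q)<+\infty\}.$$ **Theorem.** Let $f\in\mathcal P(\mathbb S^2)$ be a global minimiser of $\mathcal F$, with $\mathcal F(f)<+\infty$. Put $Q=\int_{\mathbb S^2}f(p)\big(p\otimes p-\tfrac13I\big)\,dp$. Then $p\mapsto f(p)/(Qp\cdot p-\eta)$ is integrable on $\mathbb S^2$ (the quotient being read as $0$ where $Qp\cdot p=\eta$), and with $$\Lambda=\int_{\mathbb S^2}\frac{f(p)}{Qp\cdot p-\eta}\big(p\otimes p-\tfrac13I\big)\,dp,\qquad Z=\int_{\mathbb S^2}\exp(\Lambda p\cdot p)\max(Qp\cdot p-\eta,0)\,dp$$ the following hold. 1. $Z>0$ and $f(p)=\frac1Z\exp(\Lambda p\cdot p)\max(Qp\cdot p-\eta,0)$ for almost every $p\in\mathbb S^2$. 2. The pair $(Q,\Lambda)$ solves the saddle-point problem $$\min_{Q_0\in\mathrm{dom}(J)}\ \max_{\lambda\in\mathrm{Sym}_0(3)}\ Q_0\cdot\lambda-\ln\Big(\int_{\mathbb S^2}\exp(\lambda p\cdot p)\max(Q_0p\cdot p-\eta,0)\,dp\Big);$$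 that is, $Q\in\mathrm{dom}(J)$, $\Lambda\in\mathrm{Sym}_0(3)$, the inner maximum is attained for every $Q_0\in\mathrm{dom}(J)$, $\Lambda$ attains it for $Q_0=Q$, and its value is smallest at $Q_0=Q$. 3. $Q\in\mathcal Q$ and $J(Q)=\min_{Q_0\in\mathcal Q}J(Q_0)$. -/

import Mathlib

open MeasureTheory

noncomputable section

namespace Nematic

/-- The unit sphere `𝕊²` in Euclidean `ℝ³`. -/
abbrev S2 : Type := Metric.sphere (0 : EuclideanSpace ℝ (Fin 3)) 1

/-- The surface measure `dp` on `𝕊²` (total mass `4π`). -/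
abbrev surf : Measure S2 := (volume : Measure (EuclideanSpace ℝ (Fin 3))).toSphere

/-- Real `3 × 3` matrices. -/
abbrev Mat3 : Type := Matrix (Fin 3) (Fin 3) ℝ

/-- The set of traceless symmetric `3 × 3` matrices. -/
def Sym0 : Set Mat3 := {A | A.IsSymm ∧ A.trace = 0}

/-- The physical Q-tensors: traceless symmetric matrices, all of whose eigenvalues
are larger than `-1/3`. -/
def PhysQ : Set Mat3 :=
  {Q | Q ∈ Sym0 ∧ ∀ v : ℝ, Module.End.HasEigenvalue (Matrix.toLin' Q) v → -(1 / 3 : ℝ) < v}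

/-- The number `Ap·p`. -/
def quad (A : Mat3) (p : S2) : ℝ := ∑ i, ∑ j, A i j * p.1 i * p.1 j

/-- The matrix inner product `A·B = ∑ᵢⱼ Aᵢⱼ Bᵢⱼ`. -/
def frob (A B : Mat3) : ℝ := ∑ i, ∑ j, A i j * B i j

/-- The matrix `p ⊗ p - I/3`. -/
def dev (p : S2) : Mat3 := fun i j => p.1 i * p.1 j - (1 / 3 : ℝ) * (1 : Mat3) i j

/-- The probability densities on `𝕊²` (representatives of classes in `L¹`). -/
def ProbDens : Set (S2 → ℝ) :=
  {f | Integrable f surf ∧ (∀ᵐ p ∂surf, 0 ≤ f p) ∧ ∫ p, f p ∂surf = 1}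

/-- The Q-tensor `∫ (p ⊗ p - I/3) f(p) dp` (integrated entrywise). -/
def qTensor (f : S2 → ℝ) : Mat3 := fun i j => ∫ p, dev p i j * f p ∂surf

/-- `-ln`, extended by `+∞` to non-positive arguments. -/
def negLog (x : ℝ) : EReal := if 0 < x then ((-Real.log x : ℝ) : EReal) else ⊤

/-- The integral of an extended-real function: the integral of its positive part minus that of its
negative part. In the free energy below the latter is finite for every probability density. -/
def eintegral (g : S2 → EReal) : EReal :=
  ((∫⁻ p, (g p).toENNReal ∂surf : ENNReal) : EReal)
    - ((∫⁻ p, (-g p).toENNReal ∂surf : ENNReal) : EReal)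

/-- The free energy
`𝓕(f) = ∫ f(p) ln f(p) - f(p) ln (∫ ((p·q)² - 1/3) f(q) dq - η) dp`, with values in `ℝ ∪ {+∞}`
on probability densities. In `EReal`, `0 * ⊤ = 0`. -/
def freeEnergy (η : ℝ) (f : S2 → ℝ) : EReal :=
  eintegral fun p =>
    ((f p * Real.log (f p) : ℝ) : EReal)
      + (f p : EReal) *
        negLog ((∫ q, ((inner ℝ p.1 q.1) ^ 2 - (1 / 3 : ℝ)) * f q ∂surf) - η)

/-- `f` is a global minimiser of the free energy among probability densities. The minimal
energy is required to be finite: if the energy is identically `+∞`, there is no minimiser. -/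
def IsGlobalMinimiser (η : ℝ) (f : S2 → ℝ) : Prop :=
  f ∈ ProbDens ∧ freeEnergy η f < ⊤ ∧ ∀ g ∈ ProbDens, freeEnergy η f ≤ freeEnergy η g

/-- `A(Q)`: the probability densities with Q-tensor `Q`. -/
def Admissible (Q : Mat3) : Set (S2 → ℝ) := {f | f ∈ ProbDens ∧ qTensor f = Q}

/-- The macroscopic function `J(Q) = inf {𝓕(f) : f ∈ A(Q)}`. -/
def macroJ (η : ℝ) (Q : Mat3) : EReal := ⨅ f ∈ Admissible Q, freeEnergy η f

/-- The effective domain of `J`. -/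
def domJ (η : ℝ) : Set Mat3 := {Q | Q ∈ PhysQ ∧ macroJ η Q < ⊤}

/-- `∫ exp(λp·p) max(Qp·p - η, 0) dp`. -/
def partitionFn (η : ℝ) (Q l : Mat3) : ℝ :=
  ∫ p, Real.exp (quad l p) * max (quad Q p - η) 0 ∂surf

/-- The dual objective `Q·λ - ln ∫ exp(λp·p) max(Qp·p - η, 0) dp`. -/
def dualF (η : ℝ) (Q l : Mat3) : ℝ := frob Q l - Real.log (partitionFn η Q l)

/-- `(Q, L)` solves `min_{Q₀ ∈ dom J} max_{λ ∈ Sym0} dualF η Q₀ λ`: the inner maximum is attained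
for every `Q₀ ∈ dom J`, `L` attains it at `Q`, and `Q` minimises the maximal value. -/
def SolvesSaddle (η : ℝ) (Q L : Mat3) : Prop :=
  Q ∈ domJ η ∧ L ∈ Sym0 ∧ IsMaxOn (dualF η Q) Sym0 L ∧
    ∀ Q₀ ∈ domJ η, ∃ l₀ ∈ Sym0, IsMaxOn (dualF η Q₀) Sym0 l₀ ∧ dualF η Q L ≤ dualF η Q₀ l₀

/-- `∫ f(p) / (Qp·p - η) (p ⊗ p - I/3) dp` with `Q` the Q-tensor of `f` (integrated entrywise). -/
def lagrangeTensor (η : ℝ) (f : S2 → ℝ) : Mat3 := fun i j =>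
  ∫ p, f p / (quad (qTensor f) p - η) * dev p i j ∂surf

end Nematic

end

noncomputable section

namespace Nematic

open Filter Topology

/-! For densities with Q-tensor `Q`, the energy is the entropy relative to the weight `w = max (Qp·p
- η) 0`. Hence `dualF η Q l` bounds it from below for every `l`, with equality only at the Gibbs
density (`dualF_le_freeEnergy`).

Write `dualF = -log S`, where `S` is the partition function of the exponent `lp·p - Q·l`. When `Q`
comes from a density of finite energy, `S` grows at least linearly in `l` (`spread_qTensor_pos`,
`exists_eventually_coercive`), so it has a minimiser `l`. Stationarity at `l` says that the Gibbs
density again has Q-tensor `Q` (`qTensor_gibbs`), so its energy is exactly `dualF η Q l`. A global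
minimiser `f` is thus squeezed between two equal numbers and is that Gibbs density. The same two
bounds, taken at `Q` and at `Q₀`, give the saddle-point property.

The remaining point is that the multiplier `l` equals the Lagrange tensor `Λ`
(`IsGlobalMinimiser.lagrangeTensor_eq`); this is an envelope argument. Coercivity persists near `Q`,
so `Q + tB` has a dual maximiser `l_t` whose Gibbs density competes with `f`. Therefore `dualF Q l_t
≤ 𝓕(f) ≤ dualF (Q + tB) l_t`. Dividing by `t > 0` and letting `t → 0`, with `l_t → l` along a
subsequence by compactness and uniqueness, gives `Λ·B ≤ l·B`. The choice `B = Λ - l` forces `B = 0`.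
Only a one-sided inequality is needed, so the kink of `max` does no harm. -/

instance : FirstCountableTopology Mat3 :=
  inferInstanceAs (FirstCountableTopology (Fin 3 → Fin 3 → ℝ))

instance : LocallyCompactSpace Mat3 :=
  inferInstanceAs (LocallyCompactSpace (Fin 3 → Fin 3 → ℝ))

/-! ### Algebra of quadratic forms -/

lemma quad_add (A B : Mat3) (p : S2) : quad (A + B) p = quad A p + quad B p := by
  simp only [quad, Matrix.add_apply, add_mul, Finset.sum_add_distrib]

lemma quad_smul (t : ℝ) (A : Mat3) (p : S2) : quad (t • A) p = t * quad A p := by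
  simp only [quad, Matrix.smul_apply, smul_eq_mul, Finset.mul_sum, mul_assoc]

lemma quad_neg (A : Mat3) (p : S2) : quad (-A) p = -quad A p := by
  simpa using quad_smul (-1) A p

lemma frob_add_left (A B C : Mat3) : frob (A + B) C = frob A C + frob B C := by
  simp only [frob, Matrix.add_apply, add_mul, Finset.sum_add_distrib]

lemma frob_smul_left (t : ℝ) (A C : Mat3) : frob (t • A) C = t * frob A C := by
  simp only [frob, Matrix.smul_apply, smul_eq_mul, Finset.mul_sum, mul_assoc]

lemma frob_comm (A B : Mat3) : frob A B = frob B A := by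
  simp only [frob, mul_comm]

lemma frob_add_right (A B C : Mat3) : frob A (B + C) = frob A B + frob A C := by
  rw [frob_comm, frob_add_left, frob_comm B, frob_comm C]

lemma frob_smul_right (t : ℝ) (A C : Mat3) : frob A (t • C) = t * frob A C := by
  rw [frob_comm, frob_smul_left, frob_comm]

lemma frob_zero_right (A : Mat3) : frob A 0 = 0 := by simp [frob]

lemma frob_self_nonneg (A : Mat3) : 0 ≤ frob A A :=
  Finset.sum_nonneg fun _ _ => Finset.sum_nonneg fun _ _ => mul_self_nonneg _

lemma sq_le_frob_self (A : Mat3) (i j : Fin 3) : A i j ^ 2 ≤ frob A A := by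
  have h1 : A i j * A i j ≤ ∑ j, A i j * A i j :=
    Finset.single_le_sum (f := fun j => A i j * A i j) (fun _ _ => mul_self_nonneg _)
      (Finset.mem_univ j)
  have h2 : ∑ j, A i j * A i j ≤ frob A A :=
    Finset.single_le_sum (f := fun i => ∑ j, A i j * A i j)
      (fun _ _ => Finset.sum_nonneg fun _ _ => mul_self_nonneg _) (Finset.mem_univ i)
  rw [sq]; exact h1.trans h2

lemma eq_zero_of_frob_self_nonpos {A : Mat3} (h : frob A A ≤ 0) : A = 0 := by
  ext i j
  have := sq_le_frob_self A i j
  have h0 : A i j ^ 2 = 0 := le_antisymm (this.trans h) (sq_nonneg _)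
  simpa using h0

lemma frob_self_pos {A : Mat3} (h : A ≠ 0) : 0 < frob A A := by
  by_contra hc
  exact h (eq_zero_of_frob_self_nonpos (not_lt.1 hc))

lemma Sym0.add_mem {A B : Mat3} (hA : A ∈ Sym0) (hB : B ∈ Sym0) : A + B ∈ Sym0 :=
  ⟨hA.1.add hB.1, by rw [Matrix.trace_add, hA.2, hB.2, add_zero]⟩

lemma Sym0.smul_mem {A : Mat3} (t : ℝ) (hA : A ∈ Sym0) : t • A ∈ Sym0 :=
  ⟨hA.1.smul t, by rw [Matrix.trace_smul, hA.2, smul_zero]⟩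

lemma Sym0.neg_mem {A : Mat3} (hA : A ∈ Sym0) : -A ∈ Sym0 := by
  simpa using Sym0.smul_mem (-1) hA

lemma Sym0.sub_mem {A B : Mat3} (hA : A ∈ Sym0) (hB : B ∈ Sym0) : A - B ∈ Sym0 := by
  rw [sub_eq_add_neg]; exact Sym0.add_mem hA (Sym0.neg_mem hB)

lemma Sym0.zero_mem : (0 : Mat3) ∈ Sym0 := ⟨Matrix.isSymm_zero, Matrix.trace_zero _ _⟩

lemma Sym0.exists_ne_zero : ∃ A ∈ Sym0, A ≠ (0 : Mat3) := by
  refine ⟨Matrix.diagonal ![1, -1, 0], ⟨Matrix.isSymm_diagonal _, ?_⟩, fun h => ?_⟩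
  · simp [Matrix.trace, Fin.sum_univ_three]
  · have := congrFun (congrFun h 0) 0
    simp at this

lemma isClosed_sym0 : IsClosed Sym0 := by
  have h : Sym0 = {A : Mat3 | A.transpose = A} ∩ {A : Mat3 | A.trace = 0} := rfl
  rw [h]
  exact (isClosed_eq (by fun_prop) continuous_id).inter
    (isClosed_eq (by fun_prop) continuous_const)

lemma continuous_frob : Continuous fun z : Mat3 × Mat3 => frob z.1 z.2 := by
  unfold frob
  fun_prop

lemma continuous_quad : Continuous fun z : Mat3 × S2 => quad z.1 z.2 := by
  unfold quad
  have h : ∀ i, Continuous fun z : Mat3 × S2 => z.2.1 i := fun i => by fun_prop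
  fun_prop

@[fun_prop]
lemma continuous_frob_comp {X : Type*} [TopologicalSpace X] {A B : X → Mat3} (hA : Continuous A)
    (hB : Continuous B) : Continuous fun x => frob (A x) (B x) :=
  continuous_frob.comp (hA.prodMk hB)

@[fun_prop]
lemma continuous_quad_comp {X : Type*} [TopologicalSpace X] {A : X → Mat3} {p : X → S2}
    (hA : Continuous A) (hp : Continuous p) : Continuous fun x => quad (A x) (p x) :=
  continuous_quad.comp (hA.prodMk hp)

lemma continuous_quad_right (A : Mat3) : Continuous (quad A) :=
  continuous_quad_comp continuous_const continuous_id

lemma continuous_dev (i j : Fin 3) : Continuous fun p => dev p i j := by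
  unfold dev
  fun_prop

lemma sum_sq_eq_one (p : S2) : ∑ i, p.1 i * p.1 i = 1 := by
  have h : ‖p.1‖ = 1 := by simp
  have h2 := EuclideanSpace.real_norm_sq_eq p.1
  rw [h] at h2
  simp only [← sq]
  linarith

lemma dev_mem_sym0 (p : S2) : dev p ∈ Sym0 := by
  constructor
  · ext i j
    simp only [Matrix.transpose_apply, dev, Matrix.one_apply, eq_comm (a := j)]
    ring
  · have := sum_sq_eq_one p
    simp only [Matrix.trace, Matrix.diag, dev, Matrix.one_apply_eq, Fin.sum_univ_three] at this ⊢
    linarith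

lemma frob_dev {B : Mat3} (hB : B.trace = 0) (p : S2) : frob B (dev p) = quad B p := by
  simp only [Matrix.trace, Matrix.diag, Fin.sum_univ_three] at hB
  simp only [frob, quad, dev, Fin.sum_univ_three, Matrix.one_apply]
  simp
  linear_combination (-1 / 3 : ℝ) * hB

/-- `((p·q)² - 1/3)` is the quadratic form of `q ⊗ q - I/3` at `p`. -/
lemma quad_dev (p q : S2) : quad (dev q) p = (inner ℝ p.1 q.1) ^ 2 - 1 / 3 := by
  have h := sum_sq_eq_one p
  simp only [PiLp.inner_apply, RCLike.inner_apply, conj_trivial]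
  simp only [quad, dev, Fin.sum_univ_three, Matrix.one_apply] at h ⊢
  simp
  linear_combination (-1 / 3 : ℝ) * h

/-! ### Null sets of quadratic forms -/

/-- Along every line in a direction `v` with `q v ≠ 0`, the form is a quadratic polynomial with
leading coefficient `q v`, so each such line meets the quadric in finitely many points; Fubini then
gives measure zero. -/
lemma volume_quadric_eq_zero {B : Mat3} (hB : B.IsSymm) (h0 : B ≠ 0) :
    volume {x : EuclideanSpace ℝ (Fin 3) | ∑ i, ∑ j, B i j * x i * x j = 0} = 0 := by
  set q : EuclideanSpace ℝ (Fin 3) → ℝ := fun x => ∑ i, ∑ j, B i j * x i * x j with hq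
  have hqc : Continuous q := by rw [hq]; fun_prop
  -- Polarisation: the values at `e_i` and `e_i + e_j` determine a symmetric matrix.
  obtain ⟨v, hv⟩ : ∃ v, q v ≠ 0 := by
    by_contra! hc
    apply h0
    have hsym : ∀ i j, B i j = B j i := fun i j => hB.apply j i
    have e (a b c : ℝ) : q !₂[a, b, c] = 0 := hc _
    simp only [hq, Fin.sum_univ_three] at e
    simp at e
    have e1 := e 1 0 0
    have e2 := e 0 1 0
    have e3 := e 0 0 1
    have e4 := e 1 1 0
    have e5 := e 1 0 1
    have e6 := e 0 1 1
    simp at e1 e2 e3 e4 e5 e6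
    have s1 := hsym 0 1
    have s2 := hsym 0 2
    have s3 := hsym 1 2
    ext i j
    fin_cases i <;> fin_cases j <;> simp <;> linarith
  have hm : MeasurableSet {x | q x = 0}ᶜ := (isClosed_eq hqc continuous_const).measurableSet.compl
  have key := ae_mem_of_ae_add_linearMap_mem (LinearMap.toSpanSingleton ℝ _ v)
    (volume : Measure ℝ) (volume : Measure (EuclideanSpace ℝ (Fin 3))) hm (fun y => by
      obtain ⟨b, hb⟩ : ∃ b, ∀ t : ℝ, q (y + t • v) = q v * t ^ 2 + b * t + q y := by
        refine ⟨∑ i, ∑ j, B i j * (y i * v j + v i * y j), fun t => ?_⟩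
        simp only [hq, Fin.sum_univ_three, PiLp.add_apply, PiLp.smul_apply, smul_eq_mul]
        ring
      have hfin : {t : ℝ | q (y + t • v) = 0}.Finite := by
        have hP : (Polynomial.C (q v) * Polynomial.X ^ 2 + Polynomial.C b * Polynomial.X
            + Polynomial.C (q y) : Polynomial ℝ) ≠ 0 := by
          intro h
          have := congrArg Polynomial.leadingCoeff h
          rw [Polynomial.leadingCoeff_quadratic hv] at this
          exact hv (by simpa using this)
        refine (Polynomial.finite_setOfPred_isRoot hP).subset fun t ht => ?_
        have : q (y + t • v) = 0 := ht
        rw [hb] at this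
        simpa [Polynomial.IsRoot] using this
      rw [ae_iff]
      simpa using hfin.measure_zero volume)
  rw [ae_iff] at key
  simpa using key

lemma surf_quad_eq_zero {B : Mat3} (hB : B.IsSymm) (h0 : B ≠ 0) :
    surf {p | quad B p = 0} = 0 := by
  have hm : MeasurableSet {p | quad B p = 0} :=
    (isClosed_eq (continuous_quad_right B) continuous_const).measurableSet
  rw [surf, Measure.toSphere_apply' _ hm]
  refine mul_eq_zero_of_right _ (measure_mono_null ?_ (volume_quadric_eq_zero hB h0))
  rintro _ ⟨r, -, _, ⟨p, hp, rfl⟩, rfl⟩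
  have hp' : ∑ i, ∑ j, B i j * p.1 i * p.1 j = 0 := hp
  have : ∑ i, ∑ j, B i j * (r * p.1 i) * (r * p.1 j)
      = r ^ 2 * ∑ i, ∑ j, B i j * p.1 i * p.1 j := by
    simp only [Fin.sum_univ_three]; ring
  simpa [hp'] using this

/-- On the sphere the constant `c` is the quadratic form of `c • 1`, and a nonzero traceless `A` is
never `c • 1`. -/
lemma surf_quad_eq_const {A : Mat3} (hA : A ∈ Sym0) (h0 : A ≠ 0) (c : ℝ) :
    surf {p | quad A p = c} = 0 := by
  have hs : (A - c • (1 : Mat3)).IsSymm := hA.1.sub (Matrix.isSymm_one.smul c)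
  have hne : A - c • (1 : Mat3) ≠ 0 := by
    intro h
    have hAc : A = c • (1 : Mat3) := sub_eq_zero.1 h
    have ht := hA.2
    rw [hAc, Matrix.trace_smul, Matrix.trace_one] at ht
    have hc : c = 0 := by simpa using ht
    exact h0 (by rw [hAc, hc, zero_smul])
  refine measure_mono_null (fun p hp => ?_) (surf_quad_eq_zero hs hne)
  have hp' : quad A p = c := hp
  have h1 : quad (1 : Mat3) p = 1 := by
    simpa [quad, Matrix.one_apply] using sum_sq_eq_one p
  change quad _ p = 0
  rw [sub_eq_add_neg, ← neg_smul, quad_add, quad_smul, h1, hp']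
  ring

/-! ### Continuity of integrals on the sphere -/

lemma integrable_of_continuous {g : S2 → ℝ} (hg : Continuous g) : Integrable g surf :=
  hg.integrable_of_hasCompactSupport (HasCompactSupport.of_compactSpace g)

lemma integrable_continuous_mul {g h : S2 → ℝ} (hg : Continuous g) (hh : Integrable h surf) :
    Integrable (fun p => g p * h p) surf := by
  obtain ⟨C, hC⟩ := isCompact_univ.exists_bound_of_continuousOn hg.continuousOn
  exact hh.bdd_mul hg.aestronglyMeasurable (Eventually.of_forall fun p => hC p (Set.mem_univ p))

lemma continuous_integral_of_continuous {X : Type*} [TopologicalSpace X]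
    [FirstCountableTopology X] [LocallyCompactSpace X] (μ : Measure S2) [IsFiniteMeasure μ]
    {F : X → S2 → ℝ} (hF : Continuous F.uncurry) : Continuous fun x => ∫ p, F x p ∂μ := by
  simpa using continuous_parametric_integral_of_continuous (μ := μ) hF isCompact_univ

/-! ### Q-tensors of densities -/

lemma frob_qTensor {g : S2 → ℝ} (hg : Integrable g surf) {B : Mat3} (hB : B.trace = 0) :
    frob (qTensor g) B = ∫ p, quad B p * g p ∂surf := by
  have hi : ∀ i j, Integrable (fun p => B i j * (dev p i j * g p)) surf := fun i j =>
    (integrable_continuous_mul (continuous_dev i j) hg).const_mul _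
  have : ∀ p, quad B p * g p = ∑ i, ∑ j, B i j * (dev p i j * g p) := fun p => by
    rw [← frob_dev hB p]
    simp only [frob, Finset.sum_mul, mul_assoc]
  simp only [this]
  rw [integral_finsetSum _ fun i _ => integrable_finsetSum _ fun j _ => hi i j]
  simp only [frob, qTensor]
  refine Finset.sum_congr rfl fun i _ => ?_
  rw [integral_finsetSum _ fun j _ => hi i j]
  refine Finset.sum_congr rfl fun j _ => ?_
  rw [integral_const_mul, mul_comm]

lemma qTensor_mem_sym0 {g : S2 → ℝ} (hg : Integrable g surf) : qTensor g ∈ Sym0 := by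
  constructor
  · ext i j
    have (p : S2) : dev p j i = dev p i j := (dev_mem_sym0 p).1.apply i j
    simp only [Matrix.transpose_apply, qTensor, this]
  · have hi : ∀ i ∈ Finset.univ, Integrable (fun p => dev p i i * g p) surf := fun i _ =>
      integrable_continuous_mul (continuous_dev i i) hg
    have h2 (p : S2) : ∑ i, dev p i i * g p = 0 := by
      have : ∑ i, dev p i i = 0 := (dev_mem_sym0 p).2
      rw [← Finset.sum_mul, this, zero_mul]
    simp only [Matrix.trace, Matrix.diag, qTensor]
    rw [← integral_finsetSum _ hi]
    simp [h2]

lemma quad_qTensor {g : S2 → ℝ} (hg : Integrable g surf) (p : S2) :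
    quad (qTensor g) p = ∫ q, ((inner ℝ p.1 q.1) ^ 2 - (1 / 3 : ℝ)) * g q ∂surf := by
  rw [← frob_dev (qTensor_mem_sym0 hg).2, frob_qTensor hg (dev_mem_sym0 p).2]
  refine integral_congr_ae (Eventually.of_forall fun q => ?_)
  simp only [quad_dev, real_inner_comm]

/-- For an eigenvector `v` with eigenvalue `m`, `∫ (v·p)² g = (m + 1/3)|v|²`. This is positive
because `g` has mass one and `v·p` vanishes only on a null set. -/
lemma qTensor_mem_physQ {g : S2 → ℝ} (hg : g ∈ ProbDens) : qTensor g ∈ PhysQ := by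
  obtain ⟨hi, h0, h1⟩ := hg
  refine ⟨qTensor_mem_sym0 hi, fun m hm => ?_⟩
  obtain ⟨v, hv⟩ := hm.exists_hasEigenvector
  have hv0 : v ≠ 0 := hv.2
  have hev : (qTensor g).mulVec v = m • v := by simpa using hv.apply_eq_smul
  set n : ℝ := ∑ i, v i * v i with hn
  have hnpos : 0 < n := by
    obtain ⟨i, hi⟩ : ∃ i, v i ≠ 0 := by
      by_contra! hc
      exact hv0 (funext hc)
    exact Finset.sum_pos' (fun _ _ => mul_self_nonneg _)
      ⟨i, Finset.mem_univ i, mul_self_pos.2 hi⟩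
  set V : Mat3 := fun i j => v i * v j with hV
  have hVs : V.IsSymm := by
    ext i j
    exact mul_comm (v j) (v i)
  set B : Mat3 := V - (n / 3) • (1 : Mat3) with hB
  have hBt : B.trace = 0 := by
    rw [hB, Matrix.trace_sub, Matrix.trace_smul, Matrix.trace_one]
    have : V.trace = n := rfl
    rw [this]
    simp only [Fintype.card_fin, smul_eq_mul]
    push_cast
    ring
  have hfr : frob (qTensor g) B = m * n := by
    have h3 : ∑ i, v i * (qTensor g).mulVec v i = m * n := by
      rw [hev, hn, Finset.mul_sum]
      exact Finset.sum_congr rfl fun i _ => by simp only [Pi.smul_apply, smul_eq_mul]; ring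
    have h4 : frob (qTensor g) V = m * n := by
      rw [← h3]
      simp only [frob, hV, Matrix.mulVec, dotProduct, Finset.mul_sum]
      exact Finset.sum_congr rfl fun i _ => Finset.sum_congr rfl fun j _ => by ring
    have h5 : frob (qTensor g) 1 = 0 := by
      rw [← (qTensor_mem_sym0 hi).2]
      simp [frob, Matrix.trace, Matrix.one_apply]
    rw [hB, sub_eq_add_neg, ← neg_smul, frob_add_right, frob_smul_right, h4, h5]
    ring
  have hquad (p : S2) : quad B p = quad V p - n / 3 := by
    have h1 : quad (1 : Mat3) p = 1 := by
      simpa [quad, Matrix.one_apply] using sum_sq_eq_one p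
    rw [hB, sub_eq_add_neg, ← neg_smul, quad_add, quad_smul, h1]
    ring
  have hVi : Integrable (fun p => quad V p * g p) surf :=
    integrable_continuous_mul (continuous_quad_right V) hi
  have hVnn (p : S2) : 0 ≤ quad V p := by
    have : quad V p = (∑ i, v i * p.1 i) ^ 2 := by
      simp only [quad, hV, Fin.sum_univ_three]; ring
    rw [this]; positivity
  have hpos : 0 < ∫ p, quad V p * g p ∂surf := by
    have hnn : ∀ᵐ p ∂surf, 0 ≤ quad V p * g p := by
      filter_upwards [h0] with p hp using mul_nonneg (hVnn p) hp
    refine lt_of_le_of_ne (integral_nonneg_of_ae hnn) fun hc => ?_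
    have hz := (integral_eq_zero_iff_of_nonneg_ae hnn hVi).1 hc.symm
    have hVne : V ≠ 0 := by
      intro hV0
      have : n = V.trace := rfl
      rw [hV0, Matrix.trace_zero] at this
      exact hnpos.ne' this
    have hgz : g =ᵐ[surf] 0 := by
      filter_upwards [hz, measure_eq_zero_iff_ae_notMem.1 (surf_quad_eq_zero hVs hVne)] with p hp hq
      exact (mul_eq_zero.1 hp).resolve_left hq
    rw [integral_congr_ae hgz] at h1
    simp at h1
  rw [frob_qTensor hi hBt] at hfr
  have : ∫ p, quad B p * g p ∂surf = (∫ p, quad V p * g p ∂surf) - n / 3 := by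
    simp only [hquad, sub_mul]
    rw [integral_sub hVi (hi.const_mul _), integral_const_mul, h1, mul_one]
  rw [this] at hfr
  have h5 : 0 < (m + 1 / 3) * n := by linarith
  have := (pos_iff_pos_of_mul_pos h5).2 hnpos
  linarith

/-! ### Extended integrals -/

lemma eintegral_congr_ae {G H : S2 → EReal} (h : G =ᵐ[surf] H) : eintegral G = eintegral H := by
  unfold eintegral
  rw [lintegral_congr_ae (h.mono fun p hp => by rw [hp]),
    lintegral_congr_ae (h.mono fun p (hp : G p = H p) => show (-G p).toENNReal = _ by rw [hp])]

lemma eintegral_coe {h : S2 → ℝ} (hh : Integrable h surf) :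
    eintegral (fun p => (h p : EReal)) = ((∫ p, h p ∂surf : ℝ) : EReal) := by
  have h1 (x : ℝ) : (x : EReal).toENNReal = ENNReal.ofReal x := EReal.toENNReal_of_ne_top (by simp)
  have h2 (x : ℝ) : (-(x : EReal)).toENNReal = ENNReal.ofReal (-x) := by
    rw [← EReal.coe_neg, h1]
  unfold eintegral
  simp only [h1, h2]
  have hp : ∫⁻ p, ENNReal.ofReal (h p) ∂surf ≠ ⊤ := hh.lintegral_lt_top.ne
  have hn : ∫⁻ p, ENNReal.ofReal (-h p) ∂surf ≠ ⊤ := hh.neg.lintegral_lt_top.ne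
  rw [integral_eq_lintegral_pos_part_sub_lintegral_neg_part hh, EReal.coe_sub,
    ← EReal.coe_ennreal_toReal hp, ← EReal.coe_ennreal_toReal hn]

/-- The integrable minorant makes the negative part finite. Without it `⊤ - ⊤ = ⊥` would also be
below `⊤`, and nothing could be inferred about the positive part. -/
lemma exists_integrable_of_eintegral_lt_top {G : S2 → EReal} (hG : AEMeasurable G surf)
    {h : S2 → ℝ} (hh : Integrable h surf) (hle : ∀ᵐ p ∂surf, (h p : EReal) ≤ G p)
    (hlt : eintegral G < ⊤) :
    ∃ r : S2 → ℝ, Integrable r surf ∧ (∀ᵐ p ∂surf, G p = r p) ∧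
      eintegral G = ((∫ p, r p ∂surf : ℝ) : EReal) := by
  have hneg : ∫⁻ p, (-G p).toENNReal ∂surf ≠ ⊤ := by
    refine ne_top_of_le_ne_top hh.neg.lintegral_lt_top.ne (lintegral_mono_ae ?_)
    filter_upwards [hle] with p hp
    refine EReal.toENNReal_le_toENNReal (y := ((-h p : ℝ) : EReal)) ?_
    rw [EReal.coe_neg]
    exact EReal.neg_le_neg_iff.2 hp
  have hpos : ∫⁻ p, (G p).toENNReal ∂surf ≠ ⊤ := by
    intro hc
    unfold eintegral at hlt
    rw [hc, ← EReal.coe_ennreal_toReal hneg] at hlt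
    simp at hlt
  have htop : ∀ᵐ p ∂surf, (G p).toENNReal < ⊤ := ae_lt_top' (by fun_prop) hpos
  have hr : ∀ᵐ p ∂surf, G p = ((G p).toReal : EReal) := by
    filter_upwards [htop, hle] with p hp hq
    refine (EReal.coe_toReal (fun hc => ?_) (fun hc => ?_)).symm
    · simp [hc] at hp
    · simp [hc] at hq
  have hint : Integrable (fun p => (G p).toReal) surf := by
    refine ⟨(by fun_prop : AEMeasurable (fun p => (G p).toReal) surf).aestronglyMeasurable, ?_⟩
    rw [hasFiniteIntegral_iff_norm]
    have hbd : ∀ᵐ p ∂surf, ENNReal.ofReal ‖(G p).toReal‖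
        ≤ (G p).toENNReal + (-G p).toENNReal := by
      filter_upwards [hr] with p hp
      rw [hp]
      have h1 (x : ℝ) : (x : EReal).toENNReal = ENNReal.ofReal x :=
        EReal.toENNReal_of_ne_top (by simp)
      rw [← EReal.coe_neg, h1, h1, EReal.toReal_coe, Real.norm_eq_abs]
      rcases abs_cases (G p).toReal with ⟨h, -⟩ | ⟨h, -⟩ <;> rw [h] <;> simp
    refine (lintegral_mono_ae hbd).trans_lt ?_
    rw [lintegral_add_left' (by fun_prop)]
    exact ENNReal.add_lt_top.2 ⟨hpos.lt_top, hneg.lt_top⟩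
  exact ⟨_, hint, hr, by rw [← eintegral_coe hint]; exact eintegral_congr_ae hr⟩

/-! ### The free energy as a relative entropy -/

lemma freeEnergy_eq (η : ℝ) {g : S2 → ℝ} (hg : Integrable g surf) :
    freeEnergy η g = eintegral fun p => ((g p * Real.log (g p) : ℝ) : EReal)
      + (g p : EReal) * negLog (quad (qTensor g) p - η) := by
  unfold freeEnergy
  simp only [quad_qTensor hg]

lemma measurable_negLog : Measurable negLog :=
  Measurable.ite measurableSet_Ioi (by fun_prop) measurable_const

lemma freeEnergy_of_lt_top {η : ℝ} {g : S2 → ℝ} (hg : g ∈ ProbDens) (hlt : freeEnergy η g < ⊤) :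
    (∀ᵐ p ∂surf, 0 < g p → 0 < quad (qTensor g) p - η) ∧
    Integrable (fun p => g p * Real.log (g p) - g p * Real.log (quad (qTensor g) p - η)) surf ∧
    freeEnergy η g = ((∫ p, (g p * Real.log (g p)
      - g p * Real.log (quad (qTensor g) p - η)) ∂surf : ℝ) : EReal) := by
  obtain ⟨hi, h0, -⟩ := hg
  set a : S2 → ℝ := fun p => quad (qTensor g) p - η with ha
  have hac : Continuous a := (continuous_quad_right _).sub continuous_const
  rw [freeEnergy_eq η hi] at hlt ⊢
  set G : S2 → EReal := fun p => ((g p * Real.log (g p) : ℝ) : EReal)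
      + (g p : EReal) * negLog (a p) with hG
  have hgm : AEMeasurable g surf := hi.aemeasurable
  have hGm : AEMeasurable G surf := by
    have h1 : AEMeasurable (fun p => ((g p * Real.log (g p) : ℝ) : EReal)) surf :=
      (hgm.mul (Real.measurable_log.comp_aemeasurable hgm)).coe_real_ereal
    have h2 : AEMeasurable (fun p => negLog (a p)) surf :=
      measurable_negLog.comp_aemeasurable hac.aemeasurable
    exact h1.add (hgm.coe_real_ereal.mul h2)
  -- Minorant of the integrand, from `1 - 1/x ≤ log x` and `log a ≤ a - 1`.
  have hh : Integrable (fun p => (g p - 1) + (1 - a p) * g p) surf :=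
    (hi.sub (integrable_const _)).add (integrable_continuous_mul (continuous_const.sub hac) hi)
  obtain ⟨r, hr, hGr, hint⟩ := exists_integrable_of_eintegral_lt_top hGm hh (by
    filter_upwards [h0] with p hp
    rcases hp.eq_or_lt with hz | hpos
    · simp [hG, ← hz]
    · by_cases hap : 0 < a p
      · simp only [hG, negLog, if_pos hap]
        rw [← EReal.coe_mul, ← EReal.coe_add, EReal.coe_le_coe_iff]
        have h1 : 1 - (g p)⁻¹ ≤ Real.log (g p) := Real.one_sub_inv_le_log_of_pos hpos
        have h2 : Real.log (a p) ≤ a p - 1 := Real.log_le_sub_one_of_pos hap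
        have h3 : g p * (1 - (g p)⁻¹) ≤ g p * Real.log (g p) := by gcongr
        have h4 : g p * (1 - a p) ≤ g p * -Real.log (a p) :=
          mul_le_mul_of_nonneg_left (by linarith) hp
        rw [mul_sub, mul_inv_cancel₀ hpos.ne'] at h3
        linarith
      · simp only [hG, negLog, if_neg hap]
        rw [EReal.coe_mul_top_of_pos hpos, EReal.coe_add_top]
        exact le_top) hlt
  have hsupp : ∀ᵐ p ∂surf, 0 < g p → 0 < a p := by
    filter_upwards [hGr] with p hp hpos
    by_contra hap
    simp only [hG, negLog, if_neg hap] at hp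
    rw [EReal.coe_mul_top_of_pos hpos, EReal.coe_add_top] at hp
    exact EReal.coe_ne_top _ hp.symm
  have hreq : r =ᵐ[surf] fun p => g p * Real.log (g p) - g p * Real.log (a p) := by
    filter_upwards [hGr, hsupp, h0] with p hp hs hg0
    rcases hg0.eq_or_lt with hz | hpos
    · simp only [hG, ← hz] at hp ⊢
      simpa using hp.symm
    · simp only [hG, negLog, if_pos (hs hpos)] at hp
      rw [← EReal.coe_mul, ← EReal.coe_add, EReal.coe_eq_coe_iff] at hp
      linarith
  exact ⟨hsupp, hr.congr hreq, by rw [hint, integral_congr_ae hreq]⟩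

/-- The Gibbs density with parameter `l` relative to the weight `max (Qp·p - η) 0`. -/
def gibbs (η : ℝ) (Q l : Mat3) (p : S2) : ℝ :=
  (partitionFn η Q l)⁻¹ * (Real.exp (quad l p) * max (quad Q p - η) 0)

lemma continuous_weight (η : ℝ) (Q l : Mat3) :
    Continuous fun p => Real.exp (quad l p) * max (quad Q p - η) 0 :=
  (Real.continuous_exp.comp (continuous_quad_right l)).mul
    (((continuous_quad_right Q).sub continuous_const).max continuous_const)

lemma continuous_gibbs (η : ℝ) (Q l : Mat3) : Continuous (gibbs η Q l) :=
  continuous_const.mul (continuous_weight η Q l)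

lemma gibbs_mem_probDens {η : ℝ} {Q l : Mat3} (hZ : 0 < partitionFn η Q l) :
    gibbs η Q l ∈ ProbDens := by
  refine ⟨integrable_of_continuous (continuous_gibbs η Q l), Eventually.of_forall fun p => ?_, ?_⟩
  · unfold gibbs; positivity
  · simp only [gibbs]
    rw [integral_const_mul]
    exact inv_mul_cancel₀ hZ.ne'

lemma log_gibbs {η : ℝ} {Q l : Mat3} (hZ : 0 < partitionFn η Q l) {p : S2}
    (hp : 0 < quad Q p - η) : Real.log (gibbs η Q l p)
      = quad l p - Real.log (partitionFn η Q l) + Real.log (quad Q p - η) := by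
  rw [gibbs, max_eq_left hp.le, Real.log_mul (inv_pos.2 hZ).ne' (by positivity),
    Real.log_mul (Real.exp_pos _).ne' hp.ne', Real.log_exp, Real.log_inv]
  ring

/-- The logarithm of the weight cancels, leaving an integrand linear in the density; where the
weight is zero so is the density, and `0 * ⊤ = 0` applies. -/
lemma freeEnergy_gibbs {η : ℝ} {Q l : Mat3} (hl : l ∈ Sym0) (hZ : 0 < partitionFn η Q l)
    (hQ : qTensor (gibbs η Q l) = Q) : freeEnergy η (gibbs η Q l) = (dualF η Q l : EReal) := by
  obtain ⟨hi, h0, h1⟩ := gibbs_mem_probDens hZ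
  have hlc : Continuous fun p => quad l p := continuous_quad_right l
  have hi2 : Integrable (fun p => quad l p * gibbs η Q l p
      - Real.log (partitionFn η Q l) * gibbs η Q l p) surf :=
    (integrable_continuous_mul hlc hi).sub (hi.const_mul _)
  have hint : ∫ p, (quad l p * gibbs η Q l p - Real.log (partitionFn η Q l) * gibbs η Q l p) ∂surf
      = dualF η Q l := by
    rw [integral_sub (integrable_continuous_mul hlc hi) (hi.const_mul _), integral_const_mul, h1,
      ← frob_qTensor hi hl.2, hQ, mul_one, dualF]
  rw [freeEnergy_eq η hi, hQ, ← hint, ← eintegral_coe hi2]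
  congr 1
  funext p
  by_cases hp : 0 < quad Q p - η
  · rw [negLog, if_pos hp, log_gibbs hZ hp, ← EReal.coe_mul, ← EReal.coe_add]
    congr 1
    ring
  · have : gibbs η Q l p = 0 := by rw [gibbs, max_eq_right (not_lt.1 hp)]; simp
    simp [this]

lemma sub_le_mul_log_sub {x y : ℝ} (hx : 0 < x) (hy : 0 < y) :
    x - y ≤ x * Real.log x - x * Real.log y ∧
      (x * Real.log x - x * Real.log y = x - y → x = y) := by
  have hd : 0 < y / x := div_pos hy hx
  have e1 : x * Real.log x - x * Real.log y = -(x * Real.log (y / x)) := by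
    rw [Real.log_div hy.ne' hx.ne']; ring
  have e2 : x * (y / x - 1) = y - x := by field_simp
  rw [e1]
  constructor
  · have := mul_le_mul_of_nonneg_left (Real.log_le_sub_one_of_pos hd) hx.le
    linarith
  · intro h
    by_contra hne
    have h1 : y / x ≠ 1 := fun hc => hne ((div_eq_one_iff_eq hx.ne').1 hc).symm
    have := mul_lt_mul_of_pos_left (Real.log_lt_sub_one_of_pos hd h1) hx
    linarith

/-- Gibbs' variational principle. -/
lemma dualF_le_freeEnergy {η : ℝ} {g : S2 → ℝ} (hg : g ∈ ProbDens) (hlt : freeEnergy η g < ⊤)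
    {l : Mat3} (hl : l ∈ Sym0) (hZ : 0 < partitionFn η (qTensor g) l) :
    (dualF η (qTensor g) l : EReal) ≤ freeEnergy η g ∧
      (freeEnergy η g = dualF η (qTensor g) l → g =ᵐ[surf] gibbs η (qTensor g) l) := by
  obtain ⟨hs, hr, he⟩ := freeEnergy_of_lt_top hg hlt
  obtain ⟨hi, h0, h1⟩ := hg
  obtain ⟨yi, y0, y1⟩ := gibbs_mem_probDens hZ
  set y := gibbs η (qTensor g) l with hy
  set c := Real.log (partitionFn η (qTensor g) l) with hc
  have hli : Integrable (fun p => quad l p * g p) surf :=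
    integrable_continuous_mul (continuous_quad_right l) hi
  have hlc : Integrable (fun p => quad l p * g p - c * g p) surf := hli.sub (hi.const_mul c)
  have hgy : Integrable (fun p => g p - y p) surf := hi.sub yi
  have hrl : Integrable (fun p => (g p * Real.log (g p)
    - g p * Real.log (quad (qTensor g) p - η)) - (quad l p * g p - c * g p)) surf := hr.sub hlc
  -- Gap between the two energies, with `g - y` subtracted: this has integral zero and makes `D`
  -- pointwise nonnegative. Where `g = 0`, `D` is just `y`.
  set D : S2 → ℝ := fun p => (g p * Real.log (g p)
    - g p * Real.log (quad (qTensor g) p - η)) - (quad l p * g p - c * g p) - (g p - y p) with hD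
  have hDi : Integrable D surf := hrl.sub hgy
  have hDint : ∫ p, D p ∂surf = (∫ p, (g p * Real.log (g p)
      - g p * Real.log (quad (qTensor g) p - η)) ∂surf) - dualF η (qTensor g) l := by
    rw [hD, integral_sub hrl hgy, integral_sub hr hlc, integral_sub hli (hi.const_mul c),
      integral_sub hi yi, integral_const_mul, h1, y1, ← frob_qTensor hi hl.2, dualF]
    ring
  have hDp : ∀ᵐ p ∂surf, 0 ≤ D p ∧ (D p = 0 → g p = y p) := by
    filter_upwards [hs, h0, y0] with p hsp hgp hyp
    rcases hgp.eq_or_lt with hz | hpos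
    · simp only [hD, ← hz]
      simpa using ⟨hyp, fun h => h.symm⟩
    · have ha := hsp hpos
      have hypos : 0 < y p := by
        rw [hy, gibbs, max_eq_left ha.le]
        exact mul_pos (inv_pos.2 hZ) (mul_pos (Real.exp_pos _) ha)
      have hlog := log_gibbs (l := l) hZ ha
      rw [← hy, ← hc] at hlog
      have hDe : D p = (g p * Real.log (g p) - g p * Real.log (y p)) - (g p - y p) := by
        rw [hlog]; simp only [hD]; ring
      obtain ⟨k1, k2⟩ := sub_le_mul_log_sub hpos hypos
      exact ⟨by linarith, fun h => k2 (by linarith)⟩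
  have hD0 : 0 ≤ᵐ[surf] D := hDp.mono fun p hp => hp.1
  rw [he, EReal.coe_le_coe_iff, EReal.coe_eq_coe_iff]
  constructor
  · linarith [integral_nonneg_of_ae hD0]
  · intro h
    have hz := (integral_eq_zero_iff_of_nonneg_ae hD0 hDi).1 (by linarith)
    filter_upwards [hz, hDp] with p hp hq using hq.2 hp

/-! ### The shifted partition function -/

/-- `exp (-dualF)`: the partition function of the exponent centred at its mean value. -/
@[irreducible]
def shiftedPartitionFn (η : ℝ) (Q l : Mat3) : ℝ :=
  ∫ p, Real.exp (quad l p - frob Q l) * max (quad Q p - η) 0 ∂surf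

/-- The mass of the positive part of the centred exponent; positively homogeneous in `l`. -/
def spread (η : ℝ) (Q l : Mat3) : ℝ :=
  ∫ p, max (quad l p - frob Q l) 0 * max (quad Q p - η) 0 ∂surf

lemma shiftedPartitionFn_eq (η : ℝ) (Q l : Mat3) :
    shiftedPartitionFn η Q l = Real.exp (-frob Q l) * partitionFn η Q l := by
  unfold shiftedPartitionFn partitionFn
  rw [← integral_const_mul]
  congr 1
  funext p
  rw [sub_eq_add_neg, Real.exp_add]
  ring

lemma shiftedPartitionFn_pos {η : ℝ} {Q l : Mat3} (hZ : 0 < partitionFn η Q l) :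
    0 < shiftedPartitionFn η Q l := by
  rw [shiftedPartitionFn_eq]; positivity

lemma dualF_eq_neg_log {η : ℝ} {Q l : Mat3} (hZ : 0 < partitionFn η Q l) :
    dualF η Q l = -Real.log (shiftedPartitionFn η Q l) := by
  rw [shiftedPartitionFn_eq, Real.log_mul (Real.exp_pos _).ne' hZ.ne', Real.log_exp, dualF]
  ring

lemma dualF_le_dualF_iff {η : ℝ} {Q Q' l l' : Mat3} (hZ : 0 < partitionFn η Q l)
    (hZ' : 0 < partitionFn η Q' l') : dualF η Q l ≤ dualF η Q' l' ↔
      shiftedPartitionFn η Q' l' ≤ shiftedPartitionFn η Q l := by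
  rw [dualF_eq_neg_log hZ, dualF_eq_neg_log hZ', neg_le_neg_iff,
    Real.log_le_log_iff (shiftedPartitionFn_pos hZ') (shiftedPartitionFn_pos hZ)]

lemma continuous_shiftedPartitionFn (η : ℝ) :
    Continuous fun z : Mat3 × Mat3 => shiftedPartitionFn η z.1 z.2 := by
  unfold shiftedPartitionFn
  refine continuous_integral_of_continuous surf ?_
  unfold Function.uncurry
  fun_prop

@[fun_prop]
lemma continuous_shiftedPartitionFn_comp (η : ℝ) {X : Type*} [TopologicalSpace X]
    {Q l : X → Mat3} (hQ : Continuous Q) (hl : Continuous l) :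
    Continuous fun x => shiftedPartitionFn η (Q x) (l x) :=
  (continuous_shiftedPartitionFn η).comp (hQ.prodMk hl)

lemma continuous_spread (η : ℝ) : Continuous fun z : Mat3 × Mat3 => spread η z.1 z.2 := by
  refine continuous_integral_of_continuous surf ?_
  unfold Function.uncurry
  fun_prop

lemma continuous_spread_integrand (η : ℝ) (Q l : Mat3) :
    Continuous fun p => max (quad l p - frob Q l) 0 * max (quad Q p - η) 0 := by
  fun_prop

lemma continuous_shifted_integrand (η : ℝ) (Q l : Mat3) :
    Continuous fun p => Real.exp (quad l p - frob Q l) * max (quad Q p - η) 0 := by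
  fun_prop

lemma spread_smul (η : ℝ) (Q l : Mat3) {s : ℝ} (hs : 0 ≤ s) :
    spread η Q (s • l) = s * spread η Q l := by
  unfold spread
  rw [← integral_const_mul]
  congr 1
  funext p
  rw [quad_smul, frob_smul_right, ← mul_sub, ← mul_assoc, mul_max_of_nonneg _ _ hs, mul_zero]

lemma spread_le_shiftedPartitionFn (η : ℝ) (Q l : Mat3) :
    spread η Q l ≤ shiftedPartitionFn η Q l := by
  unfold shiftedPartitionFn
  refine integral_mono (integrable_of_continuous (continuous_spread_integrand η Q l))
    (integrable_of_continuous (continuous_shifted_integrand η Q l)) fun p => ?_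
  refine mul_le_mul_of_nonneg_right (max_le ?_ (Real.exp_pos _).le) (le_max_right _ _)
  linarith [Real.add_one_le_exp (quad l p - frob Q l)]

lemma partitionFn_pos_of_spread_pos {η : ℝ} {Q l : Mat3} (h : 0 < spread η Q l) (l' : Mat3) :
    0 < partitionFn η Q l' := by
  unfold spread at h
  rw [integral_pos_iff_support_of_nonneg
    (fun p => mul_nonneg (le_max_right _ _) (le_max_right _ _))
    (integrable_of_continuous (continuous_spread_integrand η Q l))] at h
  unfold partitionFn
  rw [integral_pos_iff_support_of_nonneg
    (fun p => mul_nonneg (Real.exp_pos _).le (le_max_right _ _))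
    (integrable_of_continuous (continuous_weight η Q l'))]
  refine h.trans_le (measure_mono fun p hp => ?_)
  have hp' : max (quad l p - frob Q l) 0 * max (quad Q p - η) 0 ≠ 0 := hp
  exact mul_ne_zero (Real.exp_pos _).ne' (right_ne_zero_of_mul hp')

/-- If the spread vanished, `lp·p ≤ Q·l` would hold wherever `g > 0`. But `Q·l` is the `g`-mean of
`lp·p`, so equality would hold there, confining `g` to a null level set. -/
lemma spread_qTensor_pos {η : ℝ} {g : S2 → ℝ} (hg : g ∈ ProbDens) (hlt : freeEnergy η g < ⊤)
    {l : Mat3} (hl : l ∈ Sym0) (hl0 : l ≠ 0) : 0 < spread η (qTensor g) l := by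
  have hs := (freeEnergy_of_lt_top hg hlt).1
  obtain ⟨hi, h0, h1⟩ := hg
  set c := frob (qTensor g) l with hc
  have hnn (p : S2) : 0 ≤ max (quad l p - c) 0 * max (quad (qTensor g) p - η) 0 :=
    mul_nonneg (le_max_right _ _) (le_max_right _ _)
  refine lt_of_le_of_ne (integral_nonneg hnn) fun hz => ?_
  have hz' := (integral_eq_zero_iff_of_nonneg hnn
    (integrable_of_continuous (continuous_spread_integrand η _ l))).1 hz.symm
  have hle : 0 ≤ᵐ[surf] fun p => c * g p - quad l p * g p := by
    filter_upwards [hz', hs, h0] with p hp hsp hgp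
    rcases hgp.eq_or_lt with hgz | hpos
    · simp [← hgz]
    · have ha := hsp hpos
      have hp' : max (quad l p - c) 0 * max (quad (qTensor g) p - η) 0 = 0 := hp
      rw [max_eq_left ha.le] at hp'
      have := (mul_eq_zero.1 hp').resolve_right ha.ne'
      have h2 : quad l p ≤ c := by linarith [le_max_left (quad l p - c) 0]
      simp only [Pi.zero_apply, ← sub_mul]
      exact mul_nonneg (by linarith) hgp
  have hli : Integrable (fun p => quad l p * g p) surf :=
    integrable_continuous_mul (continuous_quad_right l) hi
  have hI : ∫ p, (c * g p - quad l p * g p) ∂surf = 0 := by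
    rw [integral_sub (hi.const_mul c) hli, integral_const_mul, h1, ← frob_qTensor hi hl.2, ← hc]
    ring
  have hzero := (integral_eq_zero_iff_of_nonneg_ae hle ((hi.const_mul c).sub hli)).1 hI
  have hgz : g =ᵐ[surf] 0 := by
    filter_upwards [hzero, measure_eq_zero_iff_ae_notMem.1 (surf_quad_eq_const hl hl0 c)]
      with p hp hq
    have hp' : c * g p - quad l p * g p = 0 := hp
    rw [← sub_mul] at hp'
    exact (mul_eq_zero.1 hp').resolve_left fun h => hq (by linarith)
  rw [integral_congr_ae hgz] at h1
  simp at h1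

/-! ### Existence of dual maximisers -/

lemma isCompact_sym0_frob_le (r : ℝ) : IsCompact {l : Mat3 | l ∈ Sym0 ∧ frob l l ≤ r} := by
  have hbox : IsCompact {l : Mat3 | ∀ i j, l i j ∈ Set.Icc (-√r) (√r)} := by
    have : IsCompact {l : Fin 3 → Fin 3 → ℝ | ∀ i, l i ∈ {v : Fin 3 → ℝ | ∀ j, v j ∈
        Set.Icc (-√r) (√r)}} :=
      isCompact_pi_infinite fun _ => isCompact_pi_infinite fun _ => isCompact_Icc
    exact this
  have hcl : IsClosed {l : Mat3 | l ∈ Sym0 ∧ frob l l ≤ r} :=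
    isClosed_sym0.inter (isClosed_le (continuous_frob.comp
      (by fun_prop : Continuous fun l : Mat3 => (l, l))) continuous_const)
  refine hbox.of_isClosed_subset hcl fun l hl i j => ?_
  have h : |l i j| ≤ √r := Real.abs_le_sqrt ((sq_le_frob_self l i j).trans hl.2)
  exact abs_le.1 h

lemma isCompact_sym0_frob_eq : IsCompact {l : Mat3 | l ∈ Sym0 ∧ frob l l = 1} :=
  (isCompact_sym0_frob_le 1).of_isClosed_subset
    (isClosed_sym0.inter (isClosed_eq (continuous_frob.comp
      (by fun_prop : Continuous fun l : Mat3 => (l, l))) continuous_const))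
    fun _ hl => ⟨hl.1, hl.2.le⟩

lemma exists_normalized {l : Mat3} (hl : l ∈ Sym0) (hl0 : l ≠ 0) :
    ∃ u ∈ Sym0, frob u u = 1 ∧ l = √(frob l l) • u := by
  have hpos : 0 < √(frob l l) := Real.sqrt_pos.2 (frob_self_pos hl0)
  refine ⟨(√(frob l l))⁻¹ • l, Sym0.smul_mem _ hl, ?_, ?_⟩
  · rw [frob_smul_left, frob_smul_right]
    have := Real.mul_self_sqrt (frob_self_nonneg l)
    field_simp
    rw [sq, this]
  · rw [smul_smul, mul_inv_cancel₀ hpos.ne', one_smul]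

/-- Compactness of the unit sphere of `Sym0` and homogeneity in `l`. The bound is uniform near `Q`
because it is later applied to perturbations of `Q` not known to lie in `domJ`. -/
lemma exists_eventually_coercive {η : ℝ} {Q : Mat3}
    (h : ∀ l ∈ Sym0, l ≠ 0 → 0 < spread η Q l) :
    ∃ c > 0, ∀ᶠ Q' in 𝓝 Q, ∀ l ∈ Sym0, c * √(frob l l) ≤ spread η Q' l := by
  obtain ⟨A, hA, hA0⟩ := Sym0.exists_ne_zero
  obtain ⟨u, hu, hu1, -⟩ := exists_normalized hA hA0
  obtain ⟨m, hm, hmin⟩ := isCompact_sym0_frob_eq.exists_isMinOn ⟨u, hu, hu1⟩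
    ((continuous_spread η).comp (by fun_prop : Continuous fun l : Mat3 => (Q, l))).continuousOn
  have hm0 : m ≠ 0 := by
    rintro rfl
    simpa [frob] using hm.2
  have hpos := h m hm.1 hm0
  refine ⟨spread η Q m / 2, half_pos hpos, ?_⟩
  have hev : ∀ᶠ Q' in 𝓝 Q, ∀ l ∈ {l : Mat3 | l ∈ Sym0 ∧ frob l l = 1},
      spread η Q m / 2 < spread η Q' l := by
    refine isCompact_sym0_frob_eq.eventually_forall_of_forall_eventually fun l hl => ?_
    have hml : spread η Q m ≤ spread η Q l := hmin hl
    have : spread η Q m / 2 < spread η Q l := by linarith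
    exact (continuous_spread η).continuousAt.eventually (lt_mem_nhds this)
  filter_upwards [hev] with Q' hQ' l hl
  by_cases hl0 : l = 0
  · subst hl0
    have : spread η Q' 0 = 0 := by simpa using spread_smul η Q' 0 le_rfl
    simp [this, frob_zero_right]
  · obtain ⟨u, hu, hu1, hlu⟩ := exists_normalized hl hl0
    rw [mul_comm]
    conv_rhs => rw [hlu, spread_smul _ _ _ (Real.sqrt_nonneg _)]
    exact mul_le_mul_of_nonneg_left (hQ' u ⟨hu, hu1⟩).le (Real.sqrt_nonneg _)

lemma exists_isMinOn_shiftedPartitionFn {η c : ℝ} {Q : Mat3} (hc : 0 < c)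
    (h : ∀ l ∈ Sym0, c * √(frob l l) ≤ spread η Q l) :
    ∃ l ∈ Sym0, IsMinOn (shiftedPartitionFn η Q) Sym0 l := by
  -- Beyond this radius, coercivity already exceeds the value at `0`.
  set R := shiftedPartitionFn η Q 0 / c with hR
  have hR0 : 0 ≤ R := by
    refine div_nonneg ?_ hc.le
    unfold shiftedPartitionFn
    exact integral_nonneg fun p => mul_nonneg (Real.exp_pos _).le (le_max_right _ _)
  have h0 : (0 : Mat3) ∈ {l : Mat3 | l ∈ Sym0 ∧ frob l l ≤ R ^ 2} :=
    ⟨Sym0.zero_mem, by rw [frob_zero_right]; positivity⟩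
  obtain ⟨m, hm, hmin⟩ := (isCompact_sym0_frob_le (R ^ 2)).exists_isMinOn ⟨0, h0⟩
    ((continuous_shiftedPartitionFn η).comp
      (by fun_prop : Continuous fun l : Mat3 => (Q, l))).continuousOn
  refine ⟨m, hm.1, fun l hl => ?_⟩
  by_cases hlR : frob l l ≤ R ^ 2
  · exact hmin ⟨hl, hlR⟩
  · have h1 : R < √(frob l l) := Real.lt_sqrt_of_sq_lt (not_le.1 hlR)
    have h2 : shiftedPartitionFn η Q m ≤ shiftedPartitionFn η Q 0 := hmin h0
    have h3 : c * R < c * √(frob l l) := mul_lt_mul_of_pos_left h1 hc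
    have h4 : c * R = shiftedPartitionFn η Q 0 := mul_div_cancel₀ _ hc.ne'
    change shiftedPartitionFn η Q m ≤ shiftedPartitionFn η Q l
    linarith [h l hl, spread_le_shiftedPartitionFn η Q l]

lemma isMaxOn_dualF {η : ℝ} {Q l : Mat3} (hZ : ∀ l, 0 < partitionFn η Q l)
    (hmin : IsMinOn (shiftedPartitionFn η Q) Sym0 l) : IsMaxOn (dualF η Q) Sym0 l :=
  fun l' hl' => (dualF_le_dualF_iff (hZ l') (hZ l)).2 (hmin hl')

/-! ### The optimality condition -/

/-- First-order condition without differentiating under the integral: convexity of `exp` gives `S(l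
+ sB) - S(l) ≤ s ∫ I s`, so `∫ I s ≥ 0` for `s > 0`, and `s → 0` concludes. -/
lemma integral_shifted_nonneg_of_isMinOn {η : ℝ} {Q l : Mat3} (hl : l ∈ Sym0)
    (hmin : IsMinOn (shiftedPartitionFn η Q) Sym0 l) {B : Mat3} (hB : B ∈ Sym0) :
    0 ≤ ∫ p, (quad B p - frob Q B) *
      (Real.exp (quad l p - frob Q l) * max (quad Q p - η) 0) ∂surf := by
  set w : S2 → ℝ := fun p => quad B p - frob Q B with hw
  have hwc : Continuous w := (continuous_quad_right B).sub continuous_const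
  set I : ℝ → S2 → ℝ := fun s p => w p *
    (Real.exp (quad (l + s • B) p - frob Q (l + s • B)) * max (quad Q p - η) 0) with hI
  have hIc : Continuous fun s => ∫ p, I s p ∂surf := by
    refine continuous_integral_of_continuous surf ?_
    unfold Function.uncurry
    simp only [hI, hw]
    fun_prop
  have hpos : ∀ s > 0, 0 ≤ ∫ p, I s p ∂surf := by
    intro s hs
    have hIi : Integrable (I s) surf :=
      integrable_of_continuous (hwc.mul (continuous_shifted_integrand η Q _))
    have h1 : shiftedPartitionFn η Q l ≤ shiftedPartitionFn η Q (l + s • B) :=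
      hmin (Sym0.add_mem hl (Sym0.smul_mem s hB))
    have h2 : shiftedPartitionFn η Q (l + s • B) - s * ∫ p, I s p ∂surf
        ≤ shiftedPartitionFn η Q l := by
      unfold shiftedPartitionFn
      rw [← integral_const_mul, ← integral_sub
        (integrable_of_continuous (continuous_shifted_integrand η Q _)) (hIi.const_mul s)]
      refine integral_mono
        ((integrable_of_continuous (continuous_shifted_integrand η Q _)).sub (hIi.const_mul s))
        (integrable_of_continuous (continuous_shifted_integrand η Q _)) fun p => ?_
      have e : quad l p - frob Q l = (quad (l + s • B) p - frob Q (l + s • B)) + -(s * w p) := by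
        simp only [hw, quad_add, quad_smul, frob_add_right, frob_smul_right]; ring
      simp only [hI]
      rw [e, Real.exp_add]
      have hk := Real.add_one_le_exp (-(s * w p))
      have hE : 0 ≤ Real.exp (quad (l + s • B) p - frob Q (l + s • B))
          * max (quad Q p - η) 0 := by positivity
      nlinarith [mul_le_mul_of_nonneg_left hk hE]
    exact nonneg_of_mul_nonneg_right (by linarith : 0 ≤ s * ∫ p, I s p ∂surf) hs
  have hlim : Tendsto (fun s => ∫ p, I s p ∂surf) (𝓝[>] 0) (𝓝 (∫ p, I 0 p ∂surf)) :=
    hIc.continuousAt.tendsto.mono_left nhdsWithin_le_nhds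
  have := ge_of_tendsto hlim (by filter_upwards [self_mem_nhdsWithin] with s hs using hpos s hs)
  simpa [hI] using this

lemma qTensor_gibbs {η : ℝ} {Q l : Mat3} (hQ : Q ∈ Sym0) (hl : l ∈ Sym0)
    (hZ : 0 < partitionFn η Q l) (hmin : IsMinOn (shiftedPartitionFn η Q) Sym0 l) :
    qTensor (gibbs η Q l) = Q := by
  obtain ⟨hi, -, h1⟩ := gibbs_mem_probDens hZ
  have hG := shiftedPartitionFn_pos hZ
  have hge : ∀ B ∈ Sym0, frob Q B ≤ frob (qTensor (gibbs η Q l)) B := by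
    intro B hB
    have h := integral_shifted_nonneg_of_isMinOn hl hmin hB
    have e (p : S2) : (quad B p - frob Q B) *
        (Real.exp (quad l p - frob Q l) * max (quad Q p - η) 0)
        = shiftedPartitionFn η Q l * (quad B p * gibbs η Q l p - frob Q B * gibbs η Q l p) := by
      rw [shiftedPartitionFn_eq, gibbs, sub_eq_add_neg (quad l p), Real.exp_add]
      field_simp
    simp only [e] at h
    rw [integral_const_mul, integral_sub
      (integrable_continuous_mul (continuous_quad_right B) hi) (hi.const_mul _),
      integral_const_mul, h1, ← frob_qTensor hi hB.2, mul_one] at h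
    linarith [nonneg_of_mul_nonneg_right h hG]
  -- Testing the one-sided condition with this `D` already gives `D·D ≤ 0`.
  set D := Q - qTensor (gibbs η Q l) with hD
  have hDs : D ∈ Sym0 := Sym0.sub_mem hQ (qTensor_mem_sym0 hi)
  have hD0 : D = 0 := by
    refine eq_zero_of_frob_self_nonpos ?_
    have h2 : frob Q D = frob D D + frob (qTensor (gibbs η Q l)) D := by
      rw [← frob_add_left, hD, sub_add_cancel]
    linarith [hge D hDs]
  exact (sub_eq_zero.1 hD0).symm

/-! ### Duality -/

lemma partitionFn_pos_of_coercive {η c : ℝ} {Q : Mat3} (hc : 0 < c)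
    (h : ∀ l ∈ Sym0, c * √(frob l l) ≤ spread η Q l) (l : Mat3) : 0 < partitionFn η Q l := by
  obtain ⟨A, hA, hA0⟩ := Sym0.exists_ne_zero
  exact partitionFn_pos_of_spread_pos
    ((mul_pos hc (Real.sqrt_pos.2 (frob_self_pos hA0))).trans_le (h A hA)) l

lemma exists_coercive_of_mem_domJ {η : ℝ} {Q : Mat3} (hQ : Q ∈ domJ η) :
    ∃ c > 0, ∀ l ∈ Sym0, c * √(frob l l) ≤ spread η Q l := by
  obtain ⟨g, hg⟩ := iInf_lt_iff.1 hQ.2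
  obtain ⟨⟨hgP, rfl⟩, hlt⟩ := iInf_lt_iff.1 hg
  obtain ⟨c, hc, hev⟩ := exists_eventually_coercive fun l hl hl0 =>
    spread_qTensor_pos hgP hlt hl hl0
  exact ⟨c, hc, hev.self_of_nhds⟩

lemma mem_domJ_qTensor {η : ℝ} {g : S2 → ℝ} (hg : g ∈ ProbDens) (hlt : freeEnergy η g < ⊤) :
    qTensor g ∈ domJ η :=
  ⟨qTensor_mem_physQ hg, (iInf₂_le g ⟨hg, rfl⟩).trans_lt hlt⟩

lemma IsGlobalMinimiser.freeEnergy_le_dualF {η : ℝ} {f : S2 → ℝ} (hf : IsGlobalMinimiser η f)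
    {Q l : Mat3} (hQ : Q ∈ Sym0) (hl : l ∈ Sym0) (hZ : 0 < partitionFn η Q l)
    (hmin : IsMinOn (shiftedPartitionFn η Q) Sym0 l) : freeEnergy η f ≤ dualF η Q l := by
  rw [← freeEnergy_gibbs hl hZ (qTensor_gibbs hQ hl hZ hmin)]
  exact hf.2.2 _ (gibbs_mem_probDens hZ)

lemma IsGlobalMinimiser.ae_eq_gibbs {η : ℝ} {f : S2 → ℝ} (hf : IsGlobalMinimiser η f)
    {l : Mat3} (hl : l ∈ Sym0) (hZ : 0 < partitionFn η (qTensor f) l)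
    (hmin : IsMinOn (shiftedPartitionFn η (qTensor f)) Sym0 l) :
    f =ᵐ[surf] gibbs η (qTensor f) l := by
  obtain ⟨h1, h2⟩ := dualF_le_freeEnergy hf.1 hf.2.1 hl hZ
  exact h2 (le_antisymm
    (hf.freeEnergy_le_dualF (qTensor_mem_sym0 hf.1.1) hl hZ hmin) h1)

/-- Where the weight is positive, equality of the densities fixes `(l - l')p·p` to a constant, which
for `l ≠ l'` happens only on a null set. -/
lemma eq_of_gibbs_ae_eq {η : ℝ} {Q l l' : Mat3} (hl : l ∈ Sym0) (hl' : l' ∈ Sym0)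
    (hZ : 0 < partitionFn η Q l) (hZ' : 0 < partitionFn η Q l')
    (h : gibbs η Q l =ᵐ[surf] gibbs η Q l') : l = l' := by
  by_contra hne
  have hnull := surf_quad_eq_const (Sym0.sub_mem hl hl') (sub_ne_zero.2 hne)
    (Real.log (partitionFn η Q l) - Real.log (partitionFn η Q l'))
  have hz : gibbs η Q l =ᵐ[surf] 0 := by
    filter_upwards [h, measure_eq_zero_iff_ae_notMem.1 hnull] with p hp hq
    by_cases ha : 0 < quad Q p - η
    · have e := congrArg Real.log hp
      rw [log_gibbs hZ ha, log_gibbs hZ' ha] at e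
      refine absurd ?_ hq
      rw [sub_eq_add_neg, quad_add, quad_neg]
      linarith
    · simp [gibbs, max_eq_right (not_lt.1 ha)]
  have h1 := (gibbs_mem_probDens hZ).2.2
  rw [integral_congr_ae hz] at h1
  simp at h1

/-! ### The Lagrange multiplier -/

lemma lagrangeTensor_eq_qTensor (η : ℝ) (f : S2 → ℝ) :
    lagrangeTensor η f = qTensor fun p => f p / (quad (qTensor f) p - η) := by
  ext i j
  simp only [lagrangeTensor, qTensor, mul_comm]

lemma measurableSet_quad_pos (η : ℝ) (Q : Mat3) : MeasurableSet {p : S2 | 0 < quad Q p - η} :=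
  (isOpen_lt continuous_const (by fun_prop)).measurableSet

/-- The weight is a factor of the Gibbs density, so division by `Qp·p - η` leaves a bounded
function. -/
lemma div_ae_eq_indicator {η : ℝ} {f : S2 → ℝ} {Q l : Mat3} (h : f =ᵐ[surf] gibbs η Q l) :
    (fun p => f p / (quad Q p - η)) =ᵐ[surf] {p | 0 < quad Q p - η}.indicator
      fun p => (partitionFn η Q l)⁻¹ * Real.exp (quad l p) := by
  filter_upwards [h] with p hp
  rw [hp, gibbs, Set.indicator_apply]
  split_ifs with ha
  · have ha' : 0 < quad Q p - η := ha
    rw [max_eq_left ha'.le]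
    field_simp
  · have ha' : quad Q p - η ≤ 0 := not_lt.1 ha
    simp [max_eq_right ha']

lemma integrable_div {η : ℝ} {f : S2 → ℝ} {Q l : Mat3} (h : f =ᵐ[surf] gibbs η Q l) :
    Integrable (fun p => f p / (quad Q p - η)) surf :=
  ((integrable_of_continuous (by fun_prop)).indicator
    (measurableSet_quad_pos η Q)).congr (div_ae_eq_indicator h).symm

/-- The one-sided derivative of the shifted partition function in the direction `B` of `Q`, up to
the contribution of the exponent. -/
@[irreducible]
def weightDeriv (η : ℝ) (Q B l : Mat3) : ℝ :=
  ∫ p in {p | 0 < quad Q p - η}, quad B p * Real.exp (quad l p - frob Q l) ∂surf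

lemma continuous_weightDeriv (η : ℝ) (Q B : Mat3) : Continuous (weightDeriv η Q B) := by
  unfold weightDeriv
  refine continuous_integral_of_continuous (surf.restrict _) ?_
  unfold Function.uncurry
  fun_prop

lemma weightDeriv_eq {η : ℝ} {f : S2 → ℝ} {l : Mat3} (hZ : 0 < partitionFn η (qTensor f) l)
    (h : f =ᵐ[surf] gibbs η (qTensor f) l) {B : Mat3} (hB : B ∈ Sym0) :
    weightDeriv η (qTensor f) B l
      = shiftedPartitionFn η (qTensor f) l * frob (lagrangeTensor η f) B := by
  rw [lagrangeTensor_eq_qTensor, frob_qTensor (integrable_div h) hB.2, weightDeriv,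
    ← integral_indicator (measurableSet_quad_pos η _), ← integral_const_mul]
  refine integral_congr_ae ?_
  filter_upwards [div_ae_eq_indicator h] with p hp
  rw [hp, shiftedPartitionFn_eq]
  simp only [Set.indicator_apply]
  split_ifs
  · rw [sub_eq_add_neg, Real.exp_add]
    field_simp
  · ring

/-- Pointwise `max (a + tb) 0 ≥ max a 0 + tb·1_{a>0}`, whatever the signs of `t` and `b`. -/
lemma shiftedPartitionFn_add_smul_ge (η : ℝ) (Q B l : Mat3) (t : ℝ) :
    Real.exp (-(t * frob B l)) * (shiftedPartitionFn η Q l + t * weightDeriv η Q B l)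
      ≤ shiftedPartitionFn η (Q + t • B) l := by
  have hS := integrable_of_continuous (continuous_shifted_integrand η Q l)
  have hW : Integrable ({p | 0 < quad Q p - η}.indicator
      fun p => quad B p * Real.exp (quad l p - frob Q l)) surf :=
    (integrable_of_continuous (by fun_prop)).indicator (measurableSet_quad_pos η Q)
  unfold shiftedPartitionFn weightDeriv
  rw [← integral_indicator (measurableSet_quad_pos η Q), ← integral_const_mul,
    ← integral_add hS (hW.const_mul t), ← integral_const_mul]
  refine integral_mono ((hS.add (hW.const_mul t)).const_mul _)
    (integrable_of_continuous (continuous_shifted_integrand η _ l)) fun p => ?_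
  have e : quad l p - frob (Q + t • B) l = -(t * frob B l) + (quad l p - frob Q l) := by
    rw [frob_add_left, frob_smul_left]; ring
  have e2 : quad (Q + t • B) p - η = (quad Q p - η) + t * quad B p := by
    rw [quad_add, quad_smul]; ring
  simp only [e, e2]
  rw [Real.exp_add, mul_assoc]
  refine mul_le_mul_of_nonneg_left ?_ (Real.exp_pos _).le
  rw [Set.indicator_apply]
  split_ifs with ha
  · have ha' : 0 < quad Q p - η := ha
    rw [max_eq_left ha'.le]
    calc _ = Real.exp (quad l p - frob Q l) * ((quad Q p - η) + t * quad B p) := by ring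
      _ ≤ _ := mul_le_mul_of_nonneg_left (le_max_left _ _) (Real.exp_pos _).le
  · have ha' : quad Q p - η ≤ 0 := not_lt.1 ha
    rw [max_eq_right ha']
    simp only [mul_zero, add_zero]
    positivity

/-- The envelope inequality at fixed `t`. The multiplier is optimal for the perturbed tensor, yet
still gives a lower bound for the energy of `f` at the unperturbed one. -/
lemma IsGlobalMinimiser.weightDeriv_le {η : ℝ} {f : S2 → ℝ} (hf : IsGlobalMinimiser η f)
    {B l : Mat3} {t : ℝ} (ht : 0 < t) (hB : B ∈ Sym0) (hl : l ∈ Sym0)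
    (hZ : 0 < partitionFn η (qTensor f) l) (hZt : 0 < partitionFn η (qTensor f + t • B) l)
    (hmin : IsMinOn (shiftedPartitionFn η (qTensor f + t • B)) Sym0 l) :
    weightDeriv η (qTensor f) B l
      ≤ shiftedPartitionFn η (qTensor f) l * (frob B l * Real.exp (t * frob B l)) := by
  set S := shiftedPartitionFn η (qTensor f) l with hS
  have hSpos : 0 < S := shiftedPartitionFn_pos hZ
  have h1 : dualF η (qTensor f) l ≤ dualF η (qTensor f + t • B) l := by
    have hQt := Sym0.add_mem (qTensor_mem_sym0 hf.1.1) (Sym0.smul_mem t hB)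
    exact EReal.coe_le_coe_iff.1 ((dualF_le_freeEnergy hf.1 hf.2.1 hl hZ).1.trans
      (hf.freeEnergy_le_dualF hQt hl hZt hmin))
  have h2 : shiftedPartitionFn η (qTensor f + t • B) l ≤ S := (dualF_le_dualF_iff hZ hZt).1 h1
  have h3 := (shiftedPartitionFn_add_smul_ge η (qTensor f) B l t).trans h2
  rw [← hS] at h3
  set x := t * frob B l with hx
  have h4 : S + t * weightDeriv η (qTensor f) B l ≤ Real.exp x * S := by
    have := mul_le_mul_of_nonneg_left h3 (Real.exp_pos x).le
    rwa [← mul_assoc, ← Real.exp_add, add_neg_cancel, Real.exp_zero, one_mul] at this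
  -- Lets the factor `t` inside `x` cancel, leaving a bound continuous at `t = 0`.
  have h5 : Real.exp x - 1 ≤ x * Real.exp x := by
    have := mul_le_mul_of_nonneg_right (Real.one_sub_le_exp_neg x) (Real.exp_pos x).le
    rw [← Real.exp_add, neg_add_cancel, Real.exp_zero] at this
    linarith
  have h6 : t * weightDeriv η (qTensor f) B l ≤ t * (S * (frob B l * Real.exp x)) := by
    have := mul_le_mul_of_nonneg_left h5 hSpos.le
    have e : t * (S * (frob B l * Real.exp x)) = S * (x * Real.exp x) := by rw [hx]; ring
    linarith
  exact le_of_mul_le_mul_left h6 ht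

lemma IsGlobalMinimiser.lagrangeTensor_eq {η : ℝ} {f : S2 → ℝ} (hf : IsGlobalMinimiser η f)
    {l : Mat3} (hl : l ∈ Sym0) (hmin : IsMinOn (shiftedPartitionFn η (qTensor f)) Sym0 l) :
    lagrangeTensor η f = l := by
  obtain ⟨c, hc, hev⟩ := exists_eventually_coercive fun l hl hl0 =>
    spread_qTensor_pos hf.1 hf.2.1 hl hl0
  set Q := qTensor f with hQ
  have hZ := partitionFn_pos_of_coercive hc hev.self_of_nhds
  have hgibbs := hf.ae_eq_gibbs hl (hZ l) hmin
  have hL : lagrangeTensor η f ∈ Sym0 := by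
    rw [lagrangeTensor_eq_qTensor]
    exact qTensor_mem_sym0 (integrable_div hgibbs)
  set B := lagrangeTensor η f - l with hBdef
  have hB : B ∈ Sym0 := Sym0.sub_mem hL hl
  set t : ℕ → ℝ := fun n => 1 / ((n : ℝ) + 1) with ht
  have htpos (n : ℕ) : 0 < t n := by simp only [ht]; positivity
  have htlim : Tendsto t atTop (𝓝 0) := tendsto_one_div_add_atTop_nhds_zero_nat
  have hQlim : Tendsto (fun n => Q + t n • B) atTop (𝓝 Q) := by
    have h1 : Continuous fun s : ℝ => Q + s • B := by fun_prop
    have h2 : Tendsto (fun s : ℝ => Q + s • B) (𝓝 0) (𝓝 Q) := by simpa using h1.tendsto 0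
    exact h2.comp htlim
  set R := shiftedPartitionFn η Q 0 + 1 with hR
  have hbd : ∀ᶠ n in atTop, shiftedPartitionFn η (Q + t n • B) 0 < R := by
    have h1 : Continuous fun Q' : Mat3 => shiftedPartitionFn η Q' 0 := by fun_prop
    exact hQlim.eventually ((h1.tendsto Q).eventually (gt_mem_nhds (lt_add_one _)))
  have hex : ∀ᶠ n in atTop, ∃ m : Mat3, (m ∈ Sym0 ∧ frob m m ≤ (R / c) ^ 2) ∧
      IsMinOn (shiftedPartitionFn η (Q + t n • B)) Sym0 m ∧
      weightDeriv η Q B m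
        ≤ shiftedPartitionFn η Q m * (frob B m * Real.exp (t n * frob B m)) := by
    -- Comparison with `l = 0` and uniform coercivity keep all the minimisers in one compact ball.
    filter_upwards [hQlim.eventually hev, hbd] with n hn hn2
    obtain ⟨m, hm, hmmin⟩ := exists_isMinOn_shiftedPartitionFn hc hn
    refine ⟨m, ⟨hm, ?_⟩, hmmin, hf.weightDeriv_le (htpos n) hB hm (hZ m)
      (partitionFn_pos_of_coercive hc hn m) hmmin⟩
    have h0 : shiftedPartitionFn η (Q + t n • B) m ≤ shiftedPartitionFn η (Q + t n • B) 0 :=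
      hmmin Sym0.zero_mem
    have h1 : c * √(frob m m) ≤ R :=
      (hn m hm).trans ((spread_le_shiftedPartitionFn _ _ _).trans (h0.trans hn2.le))
    have h2 : √(frob m m) ≤ R / c := by rwa [le_div_iff₀' hc]
    rw [← Real.sq_sqrt (frob_self_nonneg m)]
    exact pow_le_pow_left₀ (Real.sqrt_nonneg _) h2 2
  obtain ⟨m, hm⟩ := hex.choice
  obtain ⟨m₀, hm₀, φ, hφ, hlim⟩ := (isCompact_sym0_frob_le ((R / c) ^ 2)).tendsto_subseq'
    (hm.mono fun n hn => hn.1).frequently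
  have hmφ := hφ.tendsto_atTop.eventually hm
  have hQφ : Tendsto (fun n => Q + t (φ n) • B) atTop (𝓝 Q) := hQlim.comp hφ.tendsto_atTop
  have htφ : Tendsto (fun n => t (φ n)) atTop (𝓝 0) := htlim.comp hφ.tendsto_atTop
  have hlim' : Tendsto (fun n => m (φ n)) atTop (𝓝 m₀) := hlim
  have hmin₀ : IsMinOn (shiftedPartitionFn η Q) Sym0 m₀ := by
    intro l' hl'
    have h1 : Tendsto (fun n => shiftedPartitionFn η (Q + t (φ n) • B) (m (φ n))) atTop
        (𝓝 (shiftedPartitionFn η Q m₀)) :=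
      Tendsto.comp (g := fun z : Mat3 × Mat3 => shiftedPartitionFn η z.1 z.2)
        ((continuous_shiftedPartitionFn η).tendsto (Q, m₀)) (hQφ.prodMk_nhds hlim')
    have h2 : Tendsto (fun n => shiftedPartitionFn η (Q + t (φ n) • B) l') atTop
        (𝓝 (shiftedPartitionFn η Q l')) :=
      Tendsto.comp (g := fun z : Mat3 × Mat3 => shiftedPartitionFn η z.1 z.2)
        ((continuous_shiftedPartitionFn η).tendsto (Q, l')) (hQφ.prodMk_nhds tendsto_const_nhds)
    exact le_of_tendsto_of_tendsto h1 h2 (hmφ.mono fun n hn => hn.2.1 hl')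
  -- Both multipliers represent the same `f`, so the limit must be `l`.
  have hml : m₀ = l := eq_of_gibbs_ae_eq hm₀.1 hl (hZ _) (hZ _)
    ((hf.ae_eq_gibbs hm₀.1 (hZ _) hmin₀).symm.trans hgibbs)
  subst hml
  have hF : Continuous fun z : ℝ × Mat3 => shiftedPartitionFn η Q z.2 *
      (frob B z.2 * Real.exp (z.1 * frob B z.2)) := by fun_prop
  have hkey : weightDeriv η Q B m₀
      ≤ shiftedPartitionFn η Q m₀ * (frob B m₀ * Real.exp (0 * frob B m₀)) :=
    le_of_tendsto_of_tendsto (((continuous_weightDeriv η Q B).tendsto m₀).comp hlim')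
      (Tendsto.comp (g := fun z : ℝ × Mat3 => shiftedPartitionFn η Q z.2 *
        (frob B z.2 * Real.exp (z.1 * frob B z.2))) (hF.tendsto (0, m₀)) (htφ.prodMk_nhds hlim'))
      (hmφ.mono fun n hn => hn.2.2)
  rw [weightDeriv_eq (hZ m₀) hgibbs hB, zero_mul, Real.exp_zero, mul_one] at hkey
  have h1 : frob (lagrangeTensor η f) B ≤ frob B m₀ :=
    le_of_mul_le_mul_left hkey (shiftedPartitionFn_pos (hZ m₀))
  have h2 : frob (lagrangeTensor η f) B = frob B B + frob m₀ B := by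
    rw [← frob_add_left, hBdef, sub_add_cancel]
  refine sub_eq_zero.1 (eq_zero_of_frob_self_nonpos (A := B) ?_)
  linarith [frob_comm m₀ B]

end Nematic

end

theorem mainTheorem1 (η : ℝ) (f : Nematic.S2 → ℝ) (hf : Nematic.IsGlobalMinimiser η f)
    (Q L : Nematic.Mat3) (hQ : Q = Nematic.qTensor f) (hL : L = Nematic.lagrangeTensor η f) :
    (MeasureTheory.Integrable (fun p => f p / (Nematic.quad Q p - η)) Nematic.surf ∧
      0 < Nematic.partitionFn η Q L ∧
      ∀ᵐ p ∂Nematic.surf,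
        f p = (Nematic.partitionFn η Q L)⁻¹ *
          (Real.exp (Nematic.quad L p) * max (Nematic.quad Q p - η) 0)) ∧
    Nematic.SolvesSaddle η Q L ∧
    (Q ∈ Nematic.PhysQ ∧ IsMinOn (Nematic.macroJ η) Nematic.PhysQ Q) := by
  open Nematic in
  have hdom : Q ∈ domJ η := hQ ▸ mem_domJ_qTensor hf.1 hf.2.1
  obtain ⟨c, hc, hco⟩ := exists_coercive_of_mem_domJ hdom
  obtain ⟨l, hl, hmin⟩ := exists_isMinOn_shiftedPartitionFn hc hco
  have hZ := partitionFn_pos_of_coercive hc hco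
  subst hQ
  obtain rfl : L = l := hL.trans (hf.lagrangeTensor_eq hl hmin)
  have hgibbs := hf.ae_eq_gibbs hl (hZ L) hmin
  refine ⟨⟨integrable_div hgibbs, hZ L, hgibbs⟩,
    ⟨hdom, hl, isMaxOn_dualF hZ hmin, fun Q₀ hQ₀ => ?_⟩, hdom.1, fun Q₀ _ => ?_⟩
  · obtain ⟨c₀, hc₀, hco₀⟩ := exists_coercive_of_mem_domJ hQ₀
    obtain ⟨l₀, hl₀, hmin₀⟩ := exists_isMinOn_shiftedPartitionFn hc₀ hco₀
    have hZ₀ := partitionFn_pos_of_coercive hc₀ hco₀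
    refine ⟨l₀, hl₀, isMaxOn_dualF hZ₀ hmin₀, EReal.coe_le_coe_iff.1 ?_⟩
    -- The energy of `f` separates the two dual values.
    exact (dualF_le_freeEnergy hf.1 hf.2.1 hl (hZ L)).1.trans
      (hf.freeEnergy_le_dualF hQ₀.1.1 hl₀ (hZ₀ l₀) hmin₀)
  · change macroJ η _ ≤ macroJ η Q₀
    exact le_iInf₂ fun g hg => (iInf₂_le f ⟨hf.1, rfl⟩).trans (hf.2.2 g hg.1)
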